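/- Conventions. For an integral domain $A$ with quotient field $qf(A)$ and an $A$-submodule $E$ of $qf(A)$, put $E^{-1}=\{x\in qf(A) : xE\subseteq A\}$ and $E^{v}=(E^{-1})^{-1}$. For a nonzero ideal $I$ of $A$ let $$I^{w}=\{x\in qf(A) : xJ\subseteq I \text{ for some nonzero finitely generated ideal } J\subseteq A \text{ with } J^{v}=A\}.$$ A $w$-prime of $A$ is a nonzero prime ideal $P$ of $A$ with $P^{w}=P$, and $w\text{-}\dim(A)\in\mathbb{N}\cup\{\infty\}$ is the supremum of all $n\ge 0$ for which there is a strictly increasing chain $P_1\subset\cdots\subset P_n$ of $w$-primes of $A$ (so $w\text{-}\dim(A)=0$ if $A$ has no $w$-primes). $\dim$ denotes the Krull dimension, and a ring is quasilocal if it has exactly one maximal ideal. Proposition. Let $T$ be a quasilocal integral domain (not necessarily Noetherian) with maximal ideal $M$, let $k=T/M$, let $\varphi:T\to k$ be the canonical surjection, let $D$ be a proper subring of $k$, and let $R=\varphi^{-1}(D)$. Then $$w\text{-}\dim(R)=w\text{-}\dim(D)+\dim(T),$$ as an equality in $\mathbb{N}\cup\{\infty\}$. -/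

import Mathlib

namespace WOperation

variable (R : Type*) [CommRing R] [IsDomain R]

/-- `A⁻¹ = (R : A) = {x ∈ qf(R) | x A ⊆ R}`, as an `R`-submodule of the quotient field. -/
noncomputable def inverse (A : Submodule R (FractionRing R)) : Submodule R (FractionRing R) :=
  1 / A

/-- The divisorial closure `A^v = (A⁻¹)⁻¹`. -/
noncomputable def vClosure (A : Submodule R (FractionRing R)) : Submodule R (FractionRing R) :=
  inverse R (inverse R A)

/-- An ideal `I ⊆ R`, regarded as an `R`-submodule of the quotient field `qf(R)`. -/
noncomputable def toFrac (I : Ideal R) : Submodule R (FractionRing R) :=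
  IsLocalization.coeSubmodule (FractionRing R) I

/-- `J ⊆ R` is a nonzero finitely generated ideal with `J^v = R`. -/
def IsGV (J : Ideal R) : Prop :=
  J ≠ ⊥ ∧ J.FG ∧ vClosure R (toFrac R J) = toFrac R ⊤

/-- The `w`-closure: `A^w = {x ∈ qf(R) | x J ⊆ A for some nonzero finitely generated ideal
`J` of `R` with `J^v = R`}`. -/
def wClosure (A : Submodule R (FractionRing R)) : Set (FractionRing R) :=
  {x | ∃ J : Ideal R, IsGV R J ∧ ∀ j ∈ J, x * algebraMap R (FractionRing R) j ∈ A}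

/-- A `w`-prime ideal: a nonzero prime ideal `P` of `R` with `P^w = P`. -/
def IsWPrime (P : Ideal R) : Prop :=
  P ≠ ⊥ ∧ P.IsPrime ∧ wClosure R (toFrac R P) = (toFrac R P : Set (FractionRing R))

/-- The `w`-dimension: the supremum, in `ℕ ∪ {∞}`, of the numbers `n` for which there is a chain
`P₁ ⊂ ⋯ ⊂ Pₙ` of `n` (nonzero) `w`-prime ideals. The empty chain is allowed, so that the
`w`-dimension is `0` if there are no `w`-prime ideals. -/
noncomputable def wDim : ℕ∞ :=
  sSup {c : ℕ∞ | ∃ (n : ℕ) (P : Fin n → Ideal R),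
    StrictMono P ∧ (∀ i, IsWPrime R (P i)) ∧ c = (n : ℕ∞)}

end WOperation

/-! Elements of `T` outside `M` are units, so an element of `R` outside `M` divides all of `M`
inside `R`. Hence every ideal of `R` is comparable with `M`, the kernel of `R → D`. The primes of
`R` inside `M` are the contractions of primes of `T`; those containing `M` are the preimages of
primes of `D`. By `isWPrime_iff`, a nonzero prime is a `w`-prime exactly when it contains no
GV-ideal. If `J ⊆ M`, then `T ⊆ J⁻¹`, and `T ≠ R` since `D` is proper; so `M` contains no GV-ideal
and every nonzero prime inside `M` is a `w`-prime. Above `M`, GV-ideals correspond under `R → D`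
(`isGV_iff_map`). Thus the `w`-primes form two layers, one strictly below the other
(`setOf_isWPrime_eq`), and chain lengths add. -/

namespace WOperation

/-! ### Finite chains and their lengths -/

section Chains

variable {α β : Type*}

/-- `S` contains a strictly increasing chain of `n` elements. -/
def HasChain [Preorder α] (S : Set α) (n : ℕ) : Prop :=
  ∃ l : List α, l.Pairwise (· < ·) ∧ (∀ x ∈ l, x ∈ S) ∧ l.length = n

theorem hasChain_iff_fin [Preorder α] {S : Set α} {n : ℕ} :
    HasChain S n ↔ ∃ P : Fin n → α, StrictMono P ∧ ∀ i, P i ∈ S := by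
  constructor
  · rintro ⟨l, hl, hS, rfl⟩
    exact ⟨l.get, fun i j hij => List.pairwise_iff_get.1 hl i j hij,
      fun i => hS _ (List.get_mem l i)⟩
  · rintro ⟨P, hP, hS⟩
    refine ⟨List.ofFn P, ?_, ?_, by simp⟩
    · rw [List.pairwise_ofFn]
      exact fun i j hij => hP hij
    · intro x hx
      obtain ⟨i, rfl⟩ := (List.mem_ofFn' P x).1 hx
      exact hS i

theorem HasChain.mono [Preorder α] {S : Set α} {m n : ℕ} (h : HasChain S n) (hmn : m ≤ n) :
    HasChain S m := by
  obtain ⟨l, hl, hS, rfl⟩ := h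
  exact ⟨l.take m, hl.sublist (List.take_sublist m l),
    fun x hx => hS x (List.mem_of_mem_take hx), by simpa using hmn⟩

theorem hasChain_union_iff [Preorder α] {Y Z : Set α} (h : ∀ y ∈ Y, ∀ z ∈ Z, y < z) {n : ℕ} :
    HasChain (Y ∪ Z) n ↔ ∃ i j, i + j = n ∧ HasChain Y i ∧ HasChain Z j := by
  classical
  constructor
  · rintro ⟨l, hl, hS, rfl⟩
    refine ⟨_, _, (List.length_eq_length_filter_add (fun x => decide (x ∈ Y))).symm,
      ⟨_, hl.sublist List.filter_sublist, ?_, rfl⟩, ⟨_, hl.sublist List.filter_sublist, ?_, rfl⟩⟩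
    · intro x hx
      simpa using (List.mem_filter.1 hx).2
    · intro x hx
      obtain ⟨hx, hx'⟩ := List.mem_filter.1 hx
      exact (hS x hx).resolve_left (by simpa using hx')
  · rintro ⟨_, _, rfl, ⟨l, hl, hY, rfl⟩, ⟨l', hl', hZ, rfl⟩⟩
    refine ⟨l ++ l', List.pairwise_append.2 ⟨hl, hl', fun y hy z hz => h y (hY y hy) z (hZ z hz)⟩,
      fun x hx => ?_, by simp⟩
    exact (List.mem_append.1 hx).imp (hY x) (hZ x)

theorem HasChain.map [Preorder α] [Preorder β] {S : Set α} {S' : Set β} {n : ℕ}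
    (h : HasChain S n) (f : α → β) (hf : Set.MapsTo f S S')
    (hlt : ∀ x ∈ S, ∀ y ∈ S, x < y → f x < f y) : HasChain S' n := by
  obtain ⟨l, hl, hS, rfl⟩ := h
  refine ⟨l.map f, List.pairwise_map.2 (hl.imp_of_mem fun ha hb hab =>
    hlt _ (hS _ ha) _ (hS _ hb) hab), fun x hx => ?_, by simp⟩
  obtain ⟨y, hy, rfl⟩ := List.mem_map.1 hx
  exact hf (hS y hy)

/-- The order condition is required only on `S` because contraction from `T` to `R` reflects the
order only between proper ideals. -/
theorem hasChain_image_iff [PartialOrder α] [PartialOrder β] {S : Set α} (f : α → β)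
    (hf : ∀ x ∈ S, ∀ y ∈ S, f x ≤ f y ↔ x ≤ y) {n : ℕ} :
    HasChain (f '' S) n ↔ HasChain S n := by
  have hlt : ∀ x ∈ S, ∀ y ∈ S, f x < f y ↔ x < y := fun x hx y hy => by
    rw [lt_iff_le_not_ge, lt_iff_le_not_ge, hf x hx y hy, hf y hy x hx]
  refine ⟨fun h => ?_, fun h => h.map f (Set.mapsTo_image f S) fun x hx y hy => (hlt x hx y hy).2⟩
  rcases isEmpty_or_nonempty α with hα | hα
  · obtain ⟨l, hl, hS, rfl⟩ := h
    refine ⟨[], List.Pairwise.nil, by simp, ?_⟩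
    rcases l with _ | ⟨a, l⟩
    · rfl
    · obtain ⟨x, -, -⟩ := hS a (by simp)
      exact hα.elim x
  · refine h.map (Function.invFunOn f S) (fun x hx => Function.invFunOn_mem hx)
      fun x hx y hy hxy => ?_
    rw [← hlt _ (Function.invFunOn_mem hx) _ (Function.invFunOn_mem hy),
      Function.invFunOn_eq hx, Function.invFunOn_eq hy]
    exact hxy

theorem natCast_le_krullDim_iff_hasChain {A : Type*} [CommRing A] [IsDomain A] {n : ℕ} :
    (n : WithBot ℕ∞) ≤ ringKrullDim A ↔ HasChain {P : Ideal A | P ≠ ⊥ ∧ P.IsPrime} n := by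
  rw [ringKrullDim, Order.le_krullDim_iff, hasChain_iff_fin]
  constructor
  · rintro ⟨p, rfl⟩
    refine ⟨fun i => (p i.succ).asIdeal, fun i j hij => ?_, fun i => ⟨fun h => ?_, (p _).2⟩⟩
    · exact p.strictMono (Fin.succ_lt_succ_iff.2 hij)
    · have : (p 0).asIdeal < (p i.succ).asIdeal := p.strictMono (Fin.succ_pos i)
      exact not_lt_bot (this.trans_eq h)
  · rintro ⟨P, hP, hS⟩
    -- Krull dimension counts inclusions: prepending the zero ideal turns `n` nonzero primes into a
    -- series of length `n`.
    refine ⟨⟨n, Fin.cons ⟨⊥, Ideal.isPrime_bot⟩ fun i => ⟨P i, (hS i).2⟩, fun i => ?_⟩, rfl⟩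
    change (PrimeSpectrum.asIdeal _) < (PrimeSpectrum.asIdeal _)
    rcases n with _ | n
    · exact i.elim0
    · refine Fin.cases ?_ (fun i => ?_) i
      · exact bot_lt_iff_ne_bot.2 (hS _).1
      · exact hP (Fin.castSucc_lt_succ (i := i))

theorem natCast_le_add_iff {a b : ℕ∞} {n : ℕ} :
    (n : ℕ∞) ≤ a + b ↔ ∃ i j : ℕ, i + j = n ∧ (i : ℕ∞) ≤ a ∧ (j : ℕ∞) ≤ b := by
  constructor
  · intro h
    induction a with
    | top => exact ⟨n, 0, by simp⟩
    | coe a =>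
      induction b with
      | top => exact ⟨0, n, by simp⟩
      | coe b =>
        norm_cast at h
        exact ⟨min a n, n - min a n, by omega, by exact_mod_cast min_le_left _ _,
          by norm_cast; omega⟩
  · rintro ⟨i, j, rfl, hi, hj⟩
    push_cast
    exact add_le_add hi hj

end Chains

/-! ### GV-ideals and `w`-primes without fractions -/

section Domain

theorem isPrime_comap_iff_of_surjective {A B : Type*} [CommRing A] [CommRing B] (f : A →+* B)
    (hf : Function.Surjective f) {Q : Ideal B} : (Q.comap f).IsPrime ↔ Q.IsPrime := by
  refine ⟨fun h => ⟨fun hQ => h.ne_top (by rw [hQ, Ideal.comap_top]), fun {a b} hab => ?_⟩,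
    fun h => Ideal.comap_isPrime f Q⟩
  obtain ⟨a, rfl⟩ := hf a
  obtain ⟨b, rfl⟩ := hf b
  exact h.mem_or_mem (x := a) (y := b) (by rwa [Ideal.mem_comap, map_mul])

variable {A : Type*} [CommRing A]

theorem natCast_le_wDim_iff {n : ℕ} :
    (n : ℕ∞) ≤ wDim A ↔ HasChain {P : Ideal A | IsWPrime A P} n := by
  constructor
  · intro h
    by_contra hn
    have hlt : ∀ c ∈ {c : ℕ∞ | ∃ (n : ℕ) (P : Fin n → Ideal A),
        StrictMono P ∧ (∀ i, IsWPrime A (P i)) ∧ c = (n : ℕ∞)}, c ≤ ((n - 1 : ℕ) : ℕ∞) := by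
      rintro _ ⟨m, P, hP, hw, rfl⟩
      by_contra hm
      exact hn ((hasChain_iff_fin.2 ⟨P, hP, hw⟩).mono (by norm_cast at hm; omega))
    -- Needed because `n - 1` is truncated subtraction.
    have hn0 : n ≠ 0 := by
      rintro rfl
      exact hn ⟨[], by simp⟩
    have := h.trans (sSup_le hlt)
    norm_cast at this
    omega
  · intro h
    obtain ⟨P, hP, hw⟩ := hasChain_iff_fin.1 h
    exact le_sSup ⟨n, P, hP, hw, rfl⟩

theorem toFrac_top : toFrac A ⊤ = 1 := IsLocalization.coeSubmodule_top _

theorem mem_inverse_toFrac {J : Ideal A} {x : FractionRing A} :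
    x ∈ inverse A (toFrac A J) ↔
      ∀ j ∈ J, x * algebraMap A (FractionRing A) j ∈ (1 : Submodule A (FractionRing A)) := by
  rw [inverse, Submodule.mem_div_iff_forall_mul_mem]
  constructor
  · exact fun h j hj => h _ ⟨j, hj, rfl⟩
  · rintro h _ ⟨j, hj, rfl⟩
    exact h j hj

theorem vClosure_toFrac_eq_iff {J : Ideal A} :
    vClosure A (toFrac A J) = toFrac A ⊤ ↔ inverse A (toFrac A J) ≤ 1 := by
  rw [toFrac_top, vClosure]
  constructor
  · intro h x hx
    have h1 : (1 : FractionRing A) ∈ inverse A (inverse A (toFrac A J)) := by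
      rw [h]; exact Submodule.one_le.1 le_rfl
    rw [inverse, Submodule.mem_div_iff_forall_mul_mem] at h1
    simpa using h1 x hx
  · intro h
    have : inverse A (toFrac A J) = 1 := by
      refine le_antisymm h ?_
      rw [Submodule.one_le, mem_inverse_toFrac]
      exact fun j _ => Submodule.mem_one.2 ⟨j, by simp⟩
    rw [this, inverse]
    ext x
    rw [Submodule.mem_div_iff_forall_mul_mem]
    refine ⟨fun hx => by simpa using hx 1 (Submodule.one_le.1 le_rfl), fun hx y hy => ?_⟩
    simpa using Submodule.mul_mem_mul hx hy

variable [IsDomain A]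

/-- Writing an element of `J⁻¹` as `a / b` turns `J⁻¹ ⊆ A` into divisibility in `A`, which can be
compared along `R → D`. -/
theorem isGV_iff {J : Ideal A} :
    IsGV A J ↔ J ≠ ⊥ ∧ J.FG ∧ ∀ a b : A, b ≠ 0 → (∀ j ∈ J, b ∣ a * j) → b ∣ a := by
  rw [IsGV, vClosure_toFrac_eq_iff]
  refine and_congr_right fun _ => and_congr_right fun _ => ?_
  have key : ∀ a b c : A, b ≠ 0 →
      (algebraMap A (FractionRing A) a / algebraMap A (FractionRing A) b *
        algebraMap A (FractionRing A) c ∈ (1 : Submodule A (FractionRing A)) ↔ b ∣ a * c) := by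
    intro a b c hb
    have hb' : algebraMap A (FractionRing A) b ≠ 0 := by
      simpa using hb
    rw [Submodule.mem_one]
    refine exists_congr fun r => ?_
    rw [div_mul_eq_mul_div, eq_div_iff hb', ← map_mul, ← map_mul,
      (IsFractionRing.injective A (FractionRing A)).eq_iff, mul_comm r b, eq_comm]
  constructor
  · intro h a b hb hab
    have := h (mem_inverse_toFrac.2 fun j hj => (key a b j hb).2 (hab j hj))
    simpa using (key a b 1 hb).1 (by simpa using this)
  · intro h x hx
    obtain ⟨a, b, hb, rfl⟩ := IsFractionRing.div_surjective (A := A) x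
    have hb0 := nonZeroDivisors.ne_zero hb
    have := h a b hb0 fun j hj => (key a b j hb0).1 (mem_inverse_toFrac.1 hx j hj)
    simpa using (key a b 1 hb0).2 (by simpa using this)

/-- If `xJ ⊆ P` with `J` GV, then `x ∈ J⁻¹ = A`, and an element of `J` outside `P` forces `x ∈ P`.
-/
theorem isWPrime_iff {P : Ideal A} :
    IsWPrime A P ↔ P ≠ ⊥ ∧ P.IsPrime ∧ ∀ J : Ideal A, IsGV A J → ¬ J ≤ P := by
  refine and_congr_right fun _ => and_congr_right fun hP => ?_
  have hinj := IsFractionRing.injective A (FractionRing A)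
  constructor
  · intro h J hJ hJP
    have h1 : (1 : FractionRing A) ∈ wClosure A (toFrac A P) :=
      ⟨J, hJ, fun j hj => ⟨j, hJP hj, by simp⟩⟩
    rw [h] at h1
    obtain ⟨y, hy, hy1⟩ := h1
    have : y = 1 := hinj (by simpa using hy1)
    exact hP.ne_top ((Ideal.eq_top_iff_one P).2 (this ▸ hy))
  · intro h
    refine Set.Subset.antisymm ?_ ?_
    · rintro x ⟨J, hJ, hx⟩
      obtain ⟨j, hj, hjP⟩ := Set.not_subset.1 (h J hJ)
      have hx1 : x ∈ inverse A (toFrac A J) := mem_inverse_toFrac.2 fun j hj => by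
        obtain ⟨y, -, hy⟩ := hx j hj
        exact Submodule.mem_one.2 ⟨y, hy⟩
      obtain ⟨r, rfl⟩ := Submodule.mem_one.1 (vClosure_toFrac_eq_iff.1 hJ.2.2 hx1)
      obtain ⟨y, hy, hyr⟩ := hx j hj
      have : y = r * j := hinj (by simpa using hyr)
      exact ⟨r, (hP.mem_or_mem (this ▸ hy : r * j ∈ P)).resolve_right hjP, rfl⟩
    · rintro _ ⟨y, hy, rfl⟩
      have hle : inverse A (toFrac A ⊤) ≤ 1 := fun x hx => by
        simpa using mem_inverse_toFrac.1 hx 1 trivial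
      exact ⟨⊤, ⟨top_ne_bot, ⟨{1}, by simp⟩, vClosure_toFrac_eq_iff.2 hle⟩,
        fun j _ => ⟨y * j, P.mul_mem_right _ hy, by simp⟩⟩

end Domain

/-! ### Ideals of the pullback -/

section Pullback

variable {T : Type*} [CommRing T] {M : Ideal T} {D : Subring (T ⧸ M)} {R : Subring T}

/-- The canonical map from the pullback `R` of `D` to `D`. -/
def toBase (hR : R = D.comap (Ideal.Quotient.mk M)) : R →+* D :=
  ((Ideal.Quotient.mk M).comp R.subtype).codRestrict D fun x =>
    hR.le x.2

@[simp]
theorem coe_toBase (hR : R = D.comap (Ideal.Quotient.mk M)) (x : R) :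
    (toBase hR x : T ⧸ M) = Ideal.Quotient.mk M x := rfl

theorem toBase_surjective (hR : R = D.comap (Ideal.Quotient.mk M)) :
    Function.Surjective (toBase hR) := by
  rintro ⟨d, hd⟩
  obtain ⟨t, rfl⟩ := Ideal.Quotient.mk_surjective d
  exact ⟨⟨t, by rw [hR]; exact hd⟩, rfl⟩

theorem mem_of_mem_maximal (hR : R = D.comap (Ideal.Quotient.mk M)) {t : T} (ht : t ∈ M) :
    t ∈ R := by
  rw [hR, Subring.mem_comap, Ideal.Quotient.eq_zero_iff_mem.2 ht]
  exact D.zero_mem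

theorem toBase_eq_zero_iff (hR : R = D.comap (Ideal.Quotient.mk M)) {x : R} :
    toBase hR x = 0 ↔ (x : T) ∈ M := by
  rw [← Ideal.Quotient.eq_zero_iff_mem, ← coe_toBase hR, ZeroMemClass.coe_eq_zero]

theorem exists_fg_map_eq (hR : R = D.comap (Ideal.Quotient.mk M)) {I : Ideal D} (hI : I.FG) :
    ∃ J : Ideal R, J.FG ∧ J.map (toBase hR) = I := by
  classical
  obtain ⟨s, rfl⟩ := hI
  refine ⟨Ideal.span ↑(s.image (Function.surjInv (toBase_surjective hR))), ⟨_, rfl⟩, ?_⟩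
  rw [Ideal.map_span, Finset.coe_image, Set.image_image]
  simp [Function.surjInv_eq]

/-- The ideal `M` of `R` contains no GV-ideal. -/
theorem IsGV.not_le_ker [IsDomain T] (hR : R = D.comap (Ideal.Quotient.mk M)) (hD : D ≠ ⊤) {J : Ideal R}
    (hJ : IsGV R J) : ¬ J ≤ RingHom.ker (toBase hR) := by
  intro hle
  obtain ⟨hJ0, -, hdvd⟩ := isGV_iff.1 hJ
  have hm : ∀ j ∈ J, (j : T) ∈ M := fun j hj => (toBase_eq_zero_iff hR).1 (hle hj)
  obtain ⟨d, hd⟩ : ∃ d, d ∉ D := by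
    by_contra! h
    exact hD ((Subring.eq_top_iff' D).2 h)
  obtain ⟨t, rfl⟩ := Ideal.Quotient.mk_surjective d
  obtain ⟨b, hbJ, hb0⟩ := Submodule.exists_mem_ne_zero_of_ne_bot hJ0
  have hmem : ∀ j ∈ J, t * (j : T) ∈ R := fun j hj =>
    mem_of_mem_maximal hR (M.mul_mem_left _ (hm j hj))
  -- The fraction `tb / b` represents `t ∈ J⁻¹`, so the GV property would put `t` in `R`.
  obtain ⟨c, hc⟩ := hdvd ⟨t * b, hmem b hbJ⟩ b hb0 fun j hj =>
    ⟨⟨t * j, hmem j hj⟩, Subtype.ext (by simp; ring)⟩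
  have hc' : (b : T) * t = b * c := by
    have := congrArg Subtype.val hc
    simpa [mul_comm] using this
  have htc : t = c := mul_left_cancel₀ (by simpa using hb0) hc'
  have := c.2
  rw [← htc, hR] at this
  exact hd this

variable [IsLocalRing T] [M.IsMaximal]

theorem isUnit_of_notMem {t : T} (ht : t ∉ M) : IsUnit t := by
  rw [IsLocalRing.eq_maximalIdeal ‹M.IsMaximal›] at ht
  simpa using ht

theorem le_of_ne_top {Q : Ideal T} (hQ : Q ≠ ⊤) : Q ≤ M := by
  rw [IsLocalRing.eq_maximalIdeal ‹M.IsMaximal›]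
  exact IsLocalRing.le_maximalIdeal hQ

/-- An element of `R` outside `M` divides every element of `M` in `R`. -/
theorem dvd_of_mem_maximal (hR : R = D.comap (Ideal.Quotient.mk M)) {b m : R}
    (hb : (b : T) ∉ M) (hm : (m : T) ∈ M) : b ∣ m := by
  obtain ⟨c, hc⟩ := (isUnit_of_notMem hb).exists_right_inv
  refine ⟨⟨c * m, mem_of_mem_maximal hR (M.mul_mem_left _ hm)⟩, Subtype.ext ?_⟩
  simp [← mul_assoc, hc]

/-- Every ideal of `R` is comparable with `M`. -/
theorem ker_le_of_not_le (hR : R = D.comap (Ideal.Quotient.mk M)) {J : Ideal R}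
    (hJ : ¬ J ≤ RingHom.ker (toBase hR)) : RingHom.ker (toBase hR) ≤ J := by
  obtain ⟨j, hj, hjM⟩ := Set.not_subset.1 hJ
  intro m hm
  exact J.mem_of_dvd (dvd_of_mem_maximal hR (fun h => hjM ((toBase_eq_zero_iff hR).2 h))
    ((toBase_eq_zero_iff hR).1 hm)) hj

/-- A quotient in `D` lifts up to an error in `M`, and `b ∉ M` divides that error. -/
theorem dvd_iff_toBase_dvd (hR : R = D.comap (Ideal.Quotient.mk M)) {b a : R}
    (hb : toBase hR b ≠ 0) : b ∣ a ↔ toBase hR b ∣ toBase hR a := by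
  refine ⟨map_dvd _, fun ⟨d, hd⟩ => ?_⟩
  obtain ⟨c, rfl⟩ := toBase_surjective hR d
  have h1 : b ∣ a - b * c := dvd_of_mem_maximal hR (fun h => hb ((toBase_eq_zero_iff hR).2 h))
    ((toBase_eq_zero_iff hR).1 (by rw [map_sub, map_mul, hd, sub_self]))
  simpa using h1.add (dvd_mul_right b c)

/-- A proper ideal of `T` lies in `M ⊆ R`, so contracting it loses no elements. -/
theorem comap_subtype_le_iff (hR : R = D.comap (Ideal.Quotient.mk M)) {P Q : Ideal T}
    (hP : P ≠ ⊤) : P.comap R.subtype ≤ Q.comap R.subtype ↔ P ≤ Q := by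
  refine ⟨fun h t ht => ?_, fun h => Ideal.comap_mono h⟩
  exact h (show (⟨t, mem_of_mem_maximal hR (le_of_ne_top hP ht)⟩ : R) ∈ P.comap R.subtype from ht)

/-- A prime ideal of `R` contained in `M` is the contraction of a prime ideal of `T`. -/
theorem exists_comap_subtype_eq (hR : R = D.comap (Ideal.Quotient.mk M)) {P : Ideal R}
    (hP : P.IsPrime) (hle : P ≤ RingHom.ker (toBase hR)) :
    ∃ Q : Ideal T, Q.IsPrime ∧ Q.comap R.subtype = P := by
  have hM : ∀ p ∈ P, (p : T) ∈ M := fun p hp => (toBase_eq_zero_iff hR).1 (hle hp)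
  have hsmul : ∀ (t : T) (p : R) (hp : p ∈ P),
      (⟨t * p, mem_of_mem_maximal hR (M.mul_mem_left t (hM p hp))⟩ : R) ∈ P := by
    intro t p hp
    -- `(tp)² = (t²p)p` with `t²p ∈ M ⊆ R`. So `P` is already an ideal of `T`, and serves as `Q`.
    refine hP.mem_of_pow_mem 2 ?_
    have := P.mul_mem_left
      ⟨t ^ 2 * p, mem_of_mem_maximal hR (M.mul_mem_left (t ^ 2) (hM p hp))⟩ hp
    convert this using 1
    exact Subtype.ext (by simp; ring)
  let Q : Ideal T :=
    { carrier := {t | ∃ p ∈ P, (p : T) = t}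
      add_mem' := by
        rintro _ _ ⟨p, hp, rfl⟩ ⟨q, hq, rfl⟩
        exact ⟨p + q, P.add_mem hp hq, rfl⟩
      zero_mem' := ⟨0, P.zero_mem, rfl⟩
      smul_mem' := by
        rintro t _ ⟨p, hp, rfl⟩
        exact ⟨_, hsmul t p hp, rfl⟩ }
  have hQ : ∀ {t : T}, t ∈ Q ↔ ∃ p ∈ P, (p : T) = t := Iff.rfl
  refine ⟨Q, ⟨?_, ?_⟩, ?_⟩
  · rw [Ideal.ne_top_iff_one, hQ]
    rintro ⟨p, hp, hp1⟩
    have : p = 1 := Subtype.ext hp1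
    exact hP.ne_top ((Ideal.eq_top_iff_one P).2 (this ▸ hp))
  · intro a b hab
    by_cases ha : a ∈ M
    · by_cases hb : b ∈ M
      · obtain ⟨p, hp, hpab⟩ := hQ.1 hab
        have : p = (⟨a, mem_of_mem_maximal hR ha⟩ : R) * ⟨b, mem_of_mem_maximal hR hb⟩ :=
          Subtype.ext hpab
        rw [this] at hp
        exact (hP.mem_or_mem hp).imp (fun h => ⟨_, h, rfl⟩) fun h => ⟨_, h, rfl⟩
      · exact Or.inl ((Ideal.mul_unit_mem_iff_mem Q (isUnit_of_notMem hb)).1 hab)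
    · exact Or.inr ((Ideal.unit_mul_mem_iff_mem Q (isUnit_of_notMem ha)).1 hab)
  · ext x
    rw [Ideal.mem_comap, hQ]
    refine ⟨?_, fun hx => ⟨x, hx, rfl⟩⟩
    rintro ⟨p, hp, hpx⟩
    have : p = x := Subtype.ext hpx
    exact this ▸ hp

theorem comap_subtype_lt_comap_toBase (hR : R = D.comap (Ideal.Quotient.mk M)) {P : Ideal T}
    (hP : P ≠ ⊤) {Q : Ideal D} (hQ : Q ≠ ⊥) :
    P.comap R.subtype < Q.comap (toBase hR) := by
  have h1 : P.comap R.subtype ≤ RingHom.ker (toBase hR) := fun x hx =>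
    (toBase_eq_zero_iff hR).2 (le_of_ne_top hP hx)
  refine h1.trans_lt ?_
  rw [RingHom.ker_eq_comap_bot]
  exact (Ideal.orderEmbeddingOfSurjective _ (toBase_surjective hR)).strictMono
    (bot_lt_iff_ne_bot.2 hQ)

variable [IsDomain T]

theorem isGV_iff_map (hR : R = D.comap (Ideal.Quotient.mk M)) {J : Ideal R}
    (hJ : ¬ J ≤ RingHom.ker (toBase hR)) (hfg : J.FG) :
    IsGV R J ↔ IsGV D (J.map (toBase hR)) := by
  have hsurj := toBase_surjective hR
  have hmapbot : J.map (toBase hR) ≠ ⊥ := fun h => hJ ((Ideal.map_eq_bot_iff_le_ker _).1 h)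
  have hJbot : J ≠ ⊥ := by
    rintro rfl
    exact hJ bot_le
  rw [isGV_iff, isGV_iff]
  simp only [hmapbot, hJbot, hfg, hfg.map (toBase hR), ne_eq, not_false_eq_true, true_and]
  constructor
  · intro h a b hb hab
    obtain ⟨a, rfl⟩ := hsurj a
    obtain ⟨b, rfl⟩ := hsurj b
    refine (dvd_iff_toBase_dvd hR hb).1 (h a b (fun h => hb (by rw [h, map_zero])) fun j hj => ?_)
    rw [dvd_iff_toBase_dvd hR hb, map_mul]
    exact hab _ (Ideal.mem_map_of_mem _ hj)
  · intro h a b hb hab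
    -- The denominator `b` may die in `D`, so `a / b` is rewritten as `r₀ / j₀` with `j₀ ∉ M`.
    obtain ⟨j₀, hj₀, hj₀M⟩ := Set.not_subset.1 hJ
    have hj₀0 : toBase hR j₀ ≠ 0 := hj₀M
    obtain ⟨r₀, hr₀⟩ := hab j₀ hj₀
    have hdvd : toBase hR j₀ ∣ toBase hR r₀ := by
      refine h _ _ hj₀0 fun d hd => ?_
      obtain ⟨j, hj, rfl⟩ := (Ideal.mem_map_iff_of_surjective _ hsurj).1 hd
      obtain ⟨r, hr⟩ := hab j hj
      refine ⟨toBase hR r, ?_⟩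
      rw [← map_mul, ← map_mul]
      refine congrArg _ (mul_left_cancel₀ hb ?_)
      rw [← mul_assoc, ← hr₀, mul_left_comm, ← hr]
      ring
    obtain ⟨c, hc⟩ := (dvd_iff_toBase_dvd hR hj₀0).2 hdvd
    refine ⟨c, mul_right_cancel₀ (b := j₀) (fun h => hj₀0 (by rw [h, map_zero])) ?_⟩
    rw [hr₀, hc]
    ring

/-- GV-ideals pass both ways: those of `D` lift through finitely many generators, and those of `R`
have GV image because none lies in `M`. -/
theorem isWPrime_comap_iff (hR : R = D.comap (Ideal.Quotient.mk M)) (hD : D ≠ ⊤)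
    {Q : Ideal D} (hQ : Q ≠ ⊥) :
    IsWPrime R (Q.comap (toBase hR)) ↔ IsWPrime D Q := by
  have hsurj := toBase_surjective hR
  have hne : Q.comap (toBase hR) ≠ ⊥ := by
    obtain ⟨d, hd, hd0⟩ := Submodule.exists_mem_ne_zero_of_ne_bot hQ
    obtain ⟨x, rfl⟩ := hsurj d
    intro h
    have hx : x ∈ Q.comap (toBase hR) := hd
    rw [h, Ideal.mem_bot] at hx
    exact hd0 (by rw [hx, map_zero])
  rw [isWPrime_iff, isWPrime_iff, isPrime_comap_iff_of_surjective _ hsurj]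
  simp only [hne, hQ, ne_eq, not_false_eq_true, true_and]
  refine and_congr_right fun _ => ⟨fun h I hI hIQ => ?_, fun h J hJ hJQ => ?_⟩
  · obtain ⟨J, hJ, rfl⟩ := exists_fg_map_eq hR hI.2.1
    have hJker : ¬ J ≤ RingHom.ker (toBase hR) := fun hle =>
      hI.1 ((Ideal.map_eq_bot_iff_le_ker _).2 hle)
    exact h J ((isGV_iff_map hR hJker hJ).2 hI) (Ideal.map_le_iff_le_comap.1 hIQ)
  · exact h _ ((isGV_iff_map hR (hJ.not_le_ker hR hD) hJ.2.1).1 hJ)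
      (Ideal.map_le_iff_le_comap.2 hJQ)

/-- The `w`-primes of `R` are the contractions of the nonzero primes of `T` and the preimages of
the `w`-primes of `D`. -/
theorem setOf_isWPrime_eq (hR : R = D.comap (Ideal.Quotient.mk M)) (hD : D ≠ ⊤) :
    {P : Ideal R | IsWPrime R P} =
      (Ideal.comap R.subtype '' {P | P ≠ ⊥ ∧ P.IsPrime}) ∪
        (Ideal.comap (toBase hR) '' {Q | IsWPrime D Q}) := by
  have hsurj := toBase_surjective hR
  ext P
  constructor
  · intro hP
    obtain ⟨hP0, hPp, -⟩ := id hP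
    by_cases hle : P ≤ RingHom.ker (toBase hR)
    · obtain ⟨Q, hQ, rfl⟩ := exists_comap_subtype_eq hR hPp hle
      refine Or.inl ⟨Q, ⟨?_, hQ⟩, rfl⟩
      rintro rfl
      exact hP0 (Ideal.comap_bot_of_injective _ Subtype.val_injective)
    · have hker := ker_le_of_not_le hR hle
      have hP' : (P.map (toBase hR)).comap (toBase hR) = P := by
        rw [Ideal.comap_map_of_surjective' _ hsurj, sup_eq_left.2 hker]
      refine Or.inr ⟨P.map (toBase hR), ?_, hP'⟩
      refine (isWPrime_comap_iff hR hD fun h => hle ((Ideal.map_eq_bot_iff_le_ker _).1 h)).1 ?_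
      rw [hP']
      exact hP
  · rintro (⟨P, ⟨hP0, hP⟩, rfl⟩ | ⟨Q, hQ, rfl⟩)
    · refine isWPrime_iff.2 ⟨?_, Ideal.comap_isPrime _ _, fun J hJ hJP => ?_⟩
      · intro h
        refine hP0 (le_bot_iff.1 ((comap_subtype_le_iff hR hP.ne_top).1 ?_))
        rw [h]
        exact bot_le
      · exact hJ.not_le_ker hR hD fun j hj =>
          (toBase_eq_zero_iff hR).2 (le_of_ne_top hP.ne_top (hJP hj))
    · exact (isWPrime_comap_iff hR hD hQ.1).2 hQ

end Pullback

end WOperation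

theorem proposition2p2 {T : Type*} [CommRing T] [IsDomain T] [IsLocalRing T]
    (M : Ideal T) [M.IsMaximal] (D : Subring (T ⧸ M)) (hD : D ≠ ⊤)
    (R : Subring T) (hR : R = D.comap (Ideal.Quotient.mk M)) :
    (WOperation.wDim R : WithBot ℕ∞) = (WOperation.wDim D : WithBot ℕ∞) + ringKrullDim T := by
  obtain ⟨d, hd⟩ : ∃ d : ℕ∞, ringKrullDim T = d :=
    ⟨_, (WithBot.coe_unbot _ (ne_of_gt (lt_of_lt_of_le (WithBot.bot_lt_coe 0)
      ringKrullDim_nonneg_of_nontrivial))).symm⟩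
  have hdim : ∀ n : ℕ, (n : ℕ∞) ≤ d ↔
      WOperation.HasChain {P : Ideal T | P ≠ ⊥ ∧ P.IsPrime} n := fun n => by
    rw [← WOperation.natCast_le_krullDim_iff_hasChain, hd]
    exact WithBot.coe_le_coe.symm
  rw [hd, ← WithBot.coe_add, WithBot.coe_inj, add_comm]
  -- Testing against natural numbers treats finite and infinite dimensions alike.
  refine ENat.eq_of_forall_natCast_le_iff fun n => ?_
  rw [WOperation.natCast_le_wDim_iff, WOperation.natCast_le_add_iff,
    WOperation.setOf_isWPrime_eq hR hD, WOperation.hasChain_union_iff]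
  · refine exists_congr fun i => exists_congr fun j => and_congr_right fun _ => and_congr ?_ ?_
    · rw [hdim]
      exact WOperation.hasChain_image_iff _ fun P hP Q _ =>
        WOperation.comap_subtype_le_iff hR hP.2.ne_top
    · rw [WOperation.natCast_le_wDim_iff]
      exact WOperation.hasChain_image_iff _ fun P _ Q _ =>
        (Ideal.orderEmbeddingOfSurjective _ (WOperation.toBase_surjective hR)).le_iff_le
  · rintro _ ⟨P, hP, rfl⟩ _ ⟨Q, hQ, rfl⟩
    exact WOperation.comap_subtype_lt_comap_toBase hR hP.2.ne_top hQ.1
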